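/- Let $k$ be a field and let $n\ge 1$. Let $A$ be the path algebra over $k$ of the quiver $1\to 2\to\dots\to n$, with the product given by concatenation of paths. Let $\mathcal{A}_n$ be the abelian category of finite-dimensional right $A$-modules, and let $D\mathcal{A}_n$ be its bounded derived category. Let $N_n$ be the standard $A$-bimodule with support $\{(i,j)\in[1,n]\times[1,n] : i\ge j\}$: its component $e_iN_ne_j$ is a copy of $k$ if $i\ge j$ and is zero otherwise, and every path acts by the identity of $k$ between two nonzero components (for the left action, a path $i\to l$ maps $e_lN_ne_j$ to $e_iN_ne_j$; for the right action, a path $l\to j$ maps $e_iN_ne_l$ to $e_iN_ne_j$). Let $\nu_n : D\mathcal{A}_n\to D\mathcal{A}_n$ be the Nakayama functor, that is, the total left derived functor of $\operatorname{Hom}_k(\operatorname{Hom}_A(-,A),k):\mathcal{A}_n\to\mathcal{A}_n$. Then the total left derived functors $\nu_n$ and $-\otimes^{L}_{A}N_n$ exist on $D\mathcal{A}_n$, and they are isomorphic: $\nu_n\cong -\otimes^{L}_{A}N_n$ as functors $D\mathcal{A}_n\to D\mathcal{A}_n$. -/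

import Mathlib

universe w u

section BoundedDerivedCategory

open CategoryTheory Limits ZeroObject Pretriangulated HomotopicalAlgebra

namespace BoundedDerived

variable (C : Type*) [Category* C]

/-- The property of being a (strictly) bounded cochain complex. -/
def bounded [HasZeroMorphisms C] : ObjectProperty (CochainComplex C ℤ) :=
  fun K => (∃ a : ℤ, K.IsStrictlyGE a) ∧ ∃ b : ℤ, K.IsStrictlyLE b

/-- The category `Cᵇ(C)` of bounded cochain complexes in `C`. -/
abbrev Complexes [HasZeroMorphisms C] := (bounded C).FullSubcategory

/-- Quasi-isomorphisms in `Cᵇ(C)`. -/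
def quasiIso [Abelian C] : MorphismProperty (Complexes C) :=
  (HomologicalComplex.quasiIso C (ComplexShape.up ℤ)).inverseImage (bounded C).ι

section

variable [Abelian C]

/-- Bounded complexes, in the homotopy category of bounded below complexes. -/
def homotopyBounded : ObjectProperty (HomotopyCategory.Plus C) :=
  fun K => ∃ b : ℤ, CochainComplex.IsStrictlyLE (K.obj.as) b

/-- The homotopy category `Kᵇ(C)`. -/
abbrev Homotopy := (homotopyBounded C).FullSubcategory

instance : (homotopyBounded C).ContainsZero where
  exists_zero := by
    refine ⟨⟨(HomotopyCategory.quotient _ _).obj 0, ?_⟩, ?_, ?_⟩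
    · rw [HomotopyCategory.plus_quotient_obj_iff]
      exact ⟨0, inferInstance⟩
    · rw [IsZero.iff_id_eq_zero]
      ext
      exact (Functor.map_isZero (HomotopyCategory.quotient C (.up ℤ)) (isZero_zero _)).eq_of_src _ _
    · exact ⟨0, inferInstanceAs (CochainComplex.IsStrictlyLE (0 : CochainComplex C ℤ) 0)⟩

instance : (homotopyBounded C).IsStableUnderShift ℤ where
  isStableUnderShiftBy n :=
    { le_shift K hK := by
        obtain ⟨q, _⟩ := hK
        have h := CochainComplex.isStrictlyLE_shift K.obj.as q n (q - n) (by lia)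
        refine ⟨q - n, ?_⟩
        have e₁ : (K⟦n⟧).obj = (K.obj)⟦n⟧ := by with_unfolding_all rfl
        have e₂ : ((K.obj)⟦n⟧).as = (K.obj.as)⟦n⟧ := by with_unfolding_all rfl
        rw [e₁, e₂]
        exact h }

lemma isStrictlyLE_mappingCone {K L : CochainComplex C ℤ} (f : K ⟶ L)
    (n₁ n₂ : ℤ) [K.IsStrictlyLE n₁] [L.IsStrictlyLE n₂] :
    (CochainComplex.mappingCone f).IsStrictlyLE (max n₁ n₂) := by
  rw [CochainComplex.isStrictlyLE_iff]
  intro i hi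
  simp only [CochainComplex.mappingCone.isZero_X_iff]
  exact ⟨K.isZero_of_isStrictlyLE n₁ _ (by grind), L.isZero_of_isStrictlyLE n₂ _ (by grind)⟩

instance : (homotopyBounded C).IsTriangulatedClosed₃ where
  ext₃' T hT h₁ h₂ := by
    obtain ⟨n₁, _⟩ := h₁
    obtain ⟨n₂, _⟩ := h₂
    obtain ⟨m₁, _⟩ : (CochainComplex.plus C) T.obj₁.obj.as := by
      rw [← HomotopyCategory.plus_quotient_obj_iff]; exact T.obj₁.property
    obtain ⟨m₂, _⟩ : (CochainComplex.plus C) T.obj₂.obj.as := by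
      rw [← HomotopyCategory.plus_quotient_obj_iff]; exact T.obj₂.property
    obtain ⟨f : T.obj₁.obj.as ⟶ T.obj₂.obj.as, hf⟩ :=
      (HomotopyCategory.quotient _ _).map_surjective T.mor₁.hom
    have hp : (HomotopyCategory.plus C) ((HomotopyCategory.quotient _ _).obj
        (CochainComplex.mappingCone f)) := by
      rw [HomotopyCategory.plus_quotient_obj_iff]
      exact ⟨min (m₁ - 1) m₂, CochainComplex.isStrictlyGE_mappingCone f m₁ m₂ _
        (by simp) (by simp)⟩
    have hT' := (HomotopyCategory.Plus.ι C).map_distinguished _ hT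
    refine ⟨⟨_, hp⟩, ⟨_, isStrictlyLE_mappingCone C f n₁ n₂⟩, ⟨?_⟩⟩
    refine (HomotopyCategory.Plus.ι C).preimageIso (Triangle.π₃.mapIso
      (isoTriangleOfIso₁₂ _ _ hT'
        (HomotopyCategory.mappingCone_triangleh_distinguished f)
        (Iso.refl _) (Iso.refl _) ?_))
    change T.mor₁.hom ≫ 𝟙 _ = 𝟙 _ ≫ (HomotopyCategory.quotient _ _).map f
    rw [hf]
    exact (Category.comp_id _).trans (Category.id_comp _).symm

instance : (homotopyBounded C).IsTriangulated where
  toIsTriangulatedClosed₂ := .of_isTriangulatedClosed₃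

instance : (homotopyBounded C).IsVerdierLeftLocalizing
    (HomotopyCategory.Plus.subcategoryAcyclic C) where
  fac {K L} φ hK hL := by
    obtain ⟨b, hb⟩ := hK
    obtain ⟨f : K.obj.as ⟶ L.obj.as, hf⟩ :=
      (HomotopyCategory.quotient _ _).map_surjective φ.hom
    obtain ⟨m, _⟩ : (CochainComplex.plus C) L.obj.as := by
      rw [← HomotopyCategory.plus_quotient_obj_iff]; exact L.property
    have hL' : HomologicalComplex.Acyclic L.obj.as :=
      (HomotopyCategory.quotient_obj_mem_subcategoryAcyclic_iff_acyclic L.obj.as).1 hL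
    have hp : (HomotopyCategory.plus C) ((HomotopyCategory.quotient _ _).obj
        (CochainComplex.truncLE L.obj.as b)) := by
      rw [HomotopyCategory.plus_quotient_obj_iff]
      exact ⟨m, inferInstance⟩
    refine ⟨⟨_, hp⟩, ObjectProperty.homMk ((HomotopyCategory.quotient _ _).map
      (inv (CochainComplex.ιTruncLE K.obj.as b) ≫ CochainComplex.truncLEMap f b)),
      ObjectProperty.homMk ((HomotopyCategory.quotient _ _).map
      (CochainComplex.ιTruncLE L.obj.as b)), ⟨b, ?_⟩, ?_, ?_⟩
    · change (CochainComplex.truncLE L.obj.as b).IsStrictlyLE b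
      infer_instance
    · change HomotopyCategory.subcategoryAcyclic C _
      dsimp
      rw [HomotopyCategory.quotient_obj_mem_subcategoryAcyclic_iff_acyclic]
      exact hL'.truncLE _
    · ext
      change (HomotopyCategory.quotient _ _).map _ ≫ (HomotopyCategory.quotient _ _).map _ = _
      rw [← Functor.map_comp, Category.assoc, CochainComplex.ιTruncLE_naturality,
        IsIso.inv_hom_id_assoc, hf]

/-- The canonical functor `Cᵇ(C) ⥤ Kᵇ(C)`. -/
def quotient : Complexes C ⥤ Homotopy C :=
  (homotopyBounded C).lift ((HomotopyCategory.plus C).lift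
    ((bounded C).ι ⋙ HomotopyCategory.quotient C (.up ℤ))
      (fun K => (HomotopyCategory.plus_quotient_obj_iff _).2 K.property.1))
    (fun K => K.property.2)

instance : (quotient C).EssSurj where
  mem_essImage K := by
    refine ⟨⟨K.obj.obj.as, ?_, K.property⟩, ⟨Iso.refl _⟩⟩
    exact (HomotopyCategory.plus_quotient_obj_iff K.obj.obj.as).1 K.obj.property

instance : (quotient C).Full where
  map_surjective {K L} f := by
    obtain ⟨g, hg⟩ := (HomotopyCategory.quotient C (.up ℤ)).map_surjective f.hom.hom
    refine ⟨ObjectProperty.homMk g, ?_⟩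
    ext
    exact hg

lemma bounded_cylinder (K : CochainComplex C ℤ) (hK : bounded C K) :
    bounded C (HomologicalComplex.cylinder K) := by
  refine ⟨CochainComplex.plus_cylinder K hK.1, ?_⟩
  obtain ⟨n, hn⟩ := hK.2
  refine ⟨n, ?_⟩
  rw [CochainComplex.isStrictlyLE_iff]
  intro i hi
  dsimp [HomologicalComplex.cylinder]
  refine HomologicalComplex.homotopyCofiber.isZero_X _ _ ?_ (fun j hj ↦ ?_)
  · refine IsZero.of_iso ?_ ((HomologicalComplex.eval C (.up ℤ) i).mapBiprod _ _)
    simpa using K.isZero_of_isStrictlyLE n i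
  · simp only [ComplexShape.up_Rel] at hj
    exact K.isZero_of_isStrictlyLE n _ (by lia)

instance : (quotient C).IsLocalization
    ((HomologicalComplex.homotopyEquivalences C (.up ℤ)).inverseImage (bounded C).ι) :=
  Functor.isLocalization_of_essSurj_of_full_of_exists_cylinders _ _
    (fun K L f hf ↦ by
      have : IsIso ((HomotopyCategory.quotient C (.up ℤ)).map f.hom) := by
        rw [HomologicalComplex.isIso_quotient_map_iff_homotopyEquivalences]
        exact hf
      have : IsIso ((homotopyBounded C).ι.map ((quotient C).map f)) := by
        have : IsIso ((HomotopyCategory.Plus.ι C).map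
          ((homotopyBounded C).ι.map ((quotient C).map f))) := this
        exact isIso_of_reflects_iso _ (HomotopyCategory.Plus.ι C)
      exact isIso_of_reflects_iso _ (homotopyBounded C).ι) (by
    rintro K L f₀ f₁ hf
    obtain ⟨f₀, rfl⟩ := ObjectProperty.homMk_surjective f₀
    obtain ⟨f₁, rfl⟩ := ObjectProperty.homMk_surjective f₁
    replace hf := HomotopyCategory.homotopyOfEq f₀ f₁
      (((homotopyBounded C).ι ⋙ HomotopyCategory.Plus.ι _).congr_map hf)
    exact ⟨K.obj.precylinder.toFullSubcategory (bounded_cylinder C K.obj K.property),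
      Precylinder.LeftHomotopy.fullSubcategoryEquiv.symm
        { h := HomologicalComplex.cylinder.desc _ _ hf
          h₀ := HomologicalComplex.cylinder.ι₀_desc _ _ hf
          h₁ := HomologicalComplex.cylinder.ι₁_desc _ _ hf },
      ⟨HomologicalComplex.cylinder.homotopyEquiv _ (fun n ↦ ⟨n - 1, by simp⟩), rfl⟩⟩)

variable [HasDerivedCategory.{w} C]

/-- The canonical functor `Kᵇ(C) ⥤ Dᵇ(C)`. -/
noncomputable def Qh : Homotopy C ⥤ DerivedCategory.Bounded C :=
  DerivedCategory.TStructure.t.bounded.lift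
    ((homotopyBounded C).ι ⋙ DerivedCategory.Plus.Qh ⋙ DerivedCategory.Plus.ι) (fun K => by
      refine ⟨(DerivedCategory.Plus.Qh.obj K.obj).property, ?_⟩
      obtain ⟨b, hb⟩ := K.property
      refine ⟨b, ?_⟩
      exact inferInstanceAs ((DerivedCategory.Q.obj (K.obj.obj.as : CochainComplex C ℤ)).IsLE b))

/-- The canonical functor `Cᵇ(C) ⥤ Dᵇ(C)` to Mathlib's bounded derived category, sending a bounded
complex to its image in the derived category. -/
noncomputable def Q : Complexes C ⥤ DerivedCategory.Bounded C :=
  DerivedCategory.TStructure.t.bounded.lift ((bounded C).ι ⋙ DerivedCategory.Q) (fun K => by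
    obtain ⟨⟨a, ha⟩, ⟨b, hb⟩⟩ := K.property
    exact ⟨⟨a, inferInstanceAs ((DerivedCategory.Q.obj K.obj).IsGE a)⟩,
      ⟨b, inferInstanceAs ((DerivedCategory.Q.obj K.obj).IsLE b)⟩⟩)

/-- The composition `Cᵇ(C) ⥤ Kᵇ(C) ⥤ Dᵇ(C)`. -/
noncomputable def quotientCompQhIso : quotient C ⋙ Qh C ≅ Q C :=
  (DerivedCategory.TStructure.t.bounded.fullyFaithfulι.whiskeringRight _).preimageIso
    (Functor.isoWhiskerLeft (bounded C).ι (DerivedCategory.quotientCompQhIso C))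

instance : (Qh C).EssSurj where
  mem_essImage X := by
    obtain ⟨⟨a, _⟩, ⟨b, _⟩⟩ := X.property
    have : X.obj.IsGE a := by assumption
    have : X.obj.IsLE b := by assumption
    obtain ⟨K, hK₁, hK₂, ⟨e⟩⟩ := X.obj.exists_iso_Q_obj_of_isGE_of_isLE a b
    refine ⟨(quotient C).obj ⟨K, ⟨a, hK₁⟩, ⟨b, hK₂⟩⟩, ⟨DerivedCategory.TStructure.t.bounded.ι.preimageIso ?_⟩⟩
    exact (DerivedCategory.quotientCompQhIso C).app K ≪≫ e.symm

lemma isIso_Q_map_iff {K L : Complexes C} (f : K ⟶ L) :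
    IsIso ((Q C).map f) ↔ quasiIso C f := by
  rw [← isIso_iff_of_reflects_iso _ DerivedCategory.TStructure.t.bounded.ι]
  exact DerivedCategory.isIso_Q_map_iff_quasiIso C f.hom

instance : (Qh C).IsLocalization
    ((HomotopyCategory.Plus.subcategoryAcyclic C).inverseImage (homotopyBounded C).ι).trW :=
  have h : (DerivedCategory.TStructure.t (C := C)).bounded ≤
    DerivedCategory.TStructure.t.plus := inf_le_left
  have := (ObjectProperty.fullyFaithfulιOfLE h).full
  have := (ObjectProperty.fullyFaithfulιOfLE h).faithful
  ((homotopyBounded C).triangulatedLocalizerMorphism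
    (HomotopyCategory.Plus.subcategoryAcyclic C)).isLocalization_of_isLocalizedFullyFaithful
      (L₂ := DerivedCategory.Plus.Qh) (F := ObjectProperty.ιOfLE h) (Iso.refl _)

/-- The functor `Q : Cᵇ(C) ⥤ Dᵇ(C)` exhibits `Dᵇ(C)` as the localization of `Cᵇ(C)` with respect
to quasi-isomorphisms. -/
instance : (Q C).IsLocalization (quasiIso C) := by
  have : (quotient C ⋙ Qh C).IsLocalization (quasiIso C) := by
    refine Functor.IsLocalization.comp (quotient C) (Qh C)
      ((HomologicalComplex.homotopyEquivalences C (.up ℤ)).inverseImage (bounded C).ι)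
      ((HomotopyCategory.Plus.subcategoryAcyclic C).inverseImage (homotopyBounded C).ι).trW
      _ ?_ ?_ ?_
    · intro K L f hf
      rw [NatIso.isIso_map_iff (quotientCompQhIso C) f, isIso_Q_map_iff]
      exact hf
    · intro K L f hf
      exact homotopyEquivalences_le_quasiIso C (.up ℤ) _ hf
    · intro K L f hf
      let K₀ : Complexes C := ⟨K.obj.obj.as,
        (HomotopyCategory.plus_quotient_obj_iff K.obj.obj.as).1 K.obj.property, K.property⟩
      let L₀ : Complexes C := ⟨L.obj.obj.as,
        (HomotopyCategory.plus_quotient_obj_iff L.obj.obj.as).1 L.obj.property, L.property⟩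
      obtain ⟨g, rfl⟩ := (quotient C).map_surjective (X := K₀) (Y := L₀) f
      refine MorphismProperty.map_mem_map _ _ _ ?_
      rw [← isIso_Q_map_iff, ← NatIso.isIso_map_iff (quotientCompQhIso C)]
      exact Localization.inverts (Qh C) _ _ hf
  exact Functor.IsLocalization.of_iso _ (quotientCompQhIso C)

end

section LeftDerived

variable {C} {D : Type*} [Category* D] [Abelian C] [Abelian D] (F : C ⥤ D) [F.Additive]

/-- The functor `Cᵇ(C) ⥤ Cᵇ(D)` which applies an additive functor `F : C ⥤ D` degreewise. -/
def mapComplexes : Complexes C ⥤ Complexes D :=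
  (bounded D).lift ((bounded C).ι ⋙ F.mapHomologicalComplex (ComplexShape.up ℤ)) (fun K => by
    obtain ⟨⟨a, ha⟩, ⟨b, hb⟩⟩ := K.property
    exact ⟨⟨a, inferInstanceAs (CochainComplex.IsStrictlyGE
        ((F.mapHomologicalComplex (ComplexShape.up ℤ)).obj K.obj) a)⟩,
      ⟨b, inferInstanceAs (CochainComplex.IsStrictlyLE
        ((F.mapHomologicalComplex (ComplexShape.up ℤ)).obj K.obj) b)⟩⟩)

variable [HasDerivedCategory.{w} D]

/-- The additive functor `F : C ⥤ D` has a total left derived functor on bounded derived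
categories: the composite `Cᵇ(C) ⥤ Cᵇ(D) ⥤ Dᵇ(D)` has a left derived functor (a right Kan
extension) with respect to the quasi-isomorphisms of `Cᵇ(C)`. -/
abbrev HasLeftDerived : Prop :=
  (mapComplexes F ⋙ Q D).HasLeftDerivedFunctor (quasiIso C)

variable [HasDerivedCategory.{w} C]

/-- The total left derived functor `Dᵇ(C) ⥤ Dᵇ(D)` of an additive functor `F : C ⥤ D`. -/
noncomputable def leftDerived [HasLeftDerived F] :
    DerivedCategory.Bounded C ⥤ DerivedCategory.Bounded D :=
  (mapComplexes F ⋙ Q D).totalLeftDerived (Q C) (quasiIso C)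

end LeftDerived

end BoundedDerived

end BoundedDerivedCategory

namespace TypeAQuiver

open CategoryTheory
open scoped TensorProduct

section Tensor

variable {A : Type u} [Ring A]
variable (M M' M'' : Type u) [AddCommGroup M] [Module Aᵐᵒᵖ M] [AddCommGroup M'] [Module Aᵐᵒᵖ M']
  [AddCommGroup M''] [Module Aᵐᵒᵖ M'']
variable (N : Type u) [AddCommGroup N] [Module A N] [Module Aᵐᵒᵖ N] 

variable (A) in
/-- The relations `(m · a) ⊗ ν = m ⊗ (a · ν)` which define `M ⊗_A N`, for a right `A`-module `M` and an
`A`-bimodule `N` (a right `A`-module is a module over `Aᵐᵒᵖ`). The two factors are written in the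
order `N ⊗[ℤ] M` because Mathlib lets scalars act on a tensor product through its left factor: in this
way `N ⊗[ℤ] M` is a right `A`-module through the right action of `A` on `N`. -/
def balancedRelations : Submodule Aᵐᵒᵖ (N ⊗[ℤ] M) :=
  Submodule.span Aᵐᵒᵖ {x | ∃ (m : M) (a : A) (ν : N),
    x = ν ⊗ₜ[ℤ] (MulOpposite.op a • m) - (a • ν) ⊗ₜ[ℤ] m}

variable (A) in
/-- The tensor product `M ⊗_A N` of a right `A`-module `M` and an `A`-bimodule `N`, as a right
`A`-module. -/
abbrev BalancedTensor : Type u := (N ⊗[ℤ] M) ⧸ balancedRelations A M N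

variable {M M'} in
/-- The map `M ⊗_A N → M' ⊗_A N` induced by a map `f : M → M'` of right `A`-modules. -/
def BalancedTensor.map (f : M →ₗ[Aᵐᵒᵖ] M') : BalancedTensor A M N →ₗ[Aᵐᵒᵖ] BalancedTensor A M' N :=
  Submodule.mapQ _ _ (TensorProduct.AlgebraTensorModule.lTensor Aᵐᵒᵖ N (f.restrictScalars ℤ)) (by
    refine Submodule.span_le.2 ?_
    rintro _ ⟨m, a, ν, rfl⟩
    refine Submodule.subset_span ⟨f m, a, ν, ?_⟩
    simp [map_smul])

end Tensor

namespace BalancedTensor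

variable {A : Type u} [Ring A]
variable {M M' M'' : Type u} [AddCommGroup M] [Module Aᵐᵒᵖ M] [AddCommGroup M'] [Module Aᵐᵒᵖ M']
  [AddCommGroup M''] [Module Aᵐᵒᵖ M'']
variable {N : Type u} [AddCommGroup N] [Module A N] [Module Aᵐᵒᵖ N]

/-- The class of `m ⊗ ν` in `M ⊗_A N`. -/
def tmul (m : M) (ν : N) : BalancedTensor A M N :=
  Submodule.Quotient.mk (ν ⊗ₜ[ℤ] m)

lemma tmul_add (m : M) (ν ν' : N) : (tmul m (ν + ν') : BalancedTensor A M N) = tmul m ν + tmul m ν' := by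
  simp [tmul, TensorProduct.add_tmul]

lemma add_tmul (m m' : M) (ν : N) : (tmul (m + m') ν : BalancedTensor A M N) = tmul m ν + tmul m' ν := by
  simp [tmul, TensorProduct.tmul_add]

lemma tmul_zero (m : M) : (tmul m (0 : N) : BalancedTensor A M N) = 0 := by simp [tmul]

lemma zero_tmul (ν : N) : (tmul (0 : M) ν : BalancedTensor A M N) = 0 := by simp [tmul]

lemma op_smul_tmul (m : M) (a : A) (ν : N) :
    (tmul (MulOpposite.op a • m) ν : BalancedTensor A M N) = tmul m (a • ν) := by
  refine (Submodule.Quotient.eq _).2 (Submodule.subset_span ⟨m, a, ν, rfl⟩)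

lemma tmul_op_smul (m : M) (a : A) (ν : N) :
    (tmul m (MulOpposite.op a • ν) : BalancedTensor A M N) = MulOpposite.op a • tmul m ν := rfl

@[simp]
lemma map_tmul (f : M →ₗ[Aᵐᵒᵖ] M') (m : M) (ν : N) :
    map N f (tmul m ν : BalancedTensor A M N) = tmul (f m) ν := rfl

lemma span_tmul : Submodule.span Aᵐᵒᵖ {x : BalancedTensor A M N | ∃ m ν, x = tmul m ν} = ⊤ := by
  rw [eq_top_iff]
  rintro x -
  obtain ⟨y, rfl⟩ := Submodule.Quotient.mk_surjective _ x
  induction y using TensorProduct.induction_on with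
  | zero => exact zero_mem _
  | tmul ν m => exact Submodule.subset_span ⟨m, ν, rfl⟩
  | add a b ha hb => exact add_mem ha hb

lemma hom_ext {P : Type u} [AddCommGroup P] [Module Aᵐᵒᵖ P] {f g : BalancedTensor A M N →ₗ[Aᵐᵒᵖ] P}
    (h : ∀ m ν, f (tmul m ν) = g (tmul m ν)) : f = g := by
  refine LinearMap.ext_on span_tmul ?_
  rintro _ ⟨m, ν, rfl⟩
  exact h m ν

instance [Module.Finite Aᵐᵒᵖ M] [Module.Finite Aᵐᵒᵖ N] :
    Module.Finite Aᵐᵒᵖ (BalancedTensor A M N) := by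
  classical
  obtain ⟨s, hs⟩ := Module.Finite.fg_top (R := Aᵐᵒᵖ) (M := M)
  obtain ⟨t, ht⟩ := Module.Finite.fg_top (R := Aᵐᵒᵖ) (M := N)
  refine ⟨⟨Finset.image₂ tmul s t, ?_⟩⟩
  rw [eq_top_iff, ← span_tmul, Submodule.span_le]
  rintro _ ⟨m, ν, rfl⟩
  have hm : m ∈ Submodule.span Aᵐᵒᵖ (s : Set M) := hs ▸ Submodule.mem_top
  have key : tmul m ν ∈ Submodule.span Aᵐᵒᵖ
      (SetLike.coe (Finset.image₂ (tmul (A := A) (M := M) (N := N)) s t)) := ?_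
  · exact key
  induction hm using Submodule.span_induction generalizing ν with
  | zero => rw [zero_tmul]; exact zero_mem _
  | add x y _ _ hx hy => rw [add_tmul]; exact add_mem (hx ν) (hy ν)
  | smul a x _ hx =>
    rw [← MulOpposite.op_unop a, op_smul_tmul]
    exact hx _
  | mem x hx =>
    have hν : ν ∈ Submodule.span Aᵐᵒᵖ (t : Set N) := ht ▸ Submodule.mem_top
    induction hν using Submodule.span_induction with
    | zero => rw [tmul_zero]; exact zero_mem _
    | add y z _ _ hy hz => rw [tmul_add]; exact add_mem hy hz
    | smul a y _ hy =>
      rw [← MulOpposite.op_unop a, tmul_op_smul]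
      exact Submodule.smul_mem _ _ hy
    | mem y hy =>
      exact Submodule.subset_span (Finset.mem_image₂_of_mem hx hy)

end BalancedTensor

section

variable (A : Type u) [Ring A] (N : Type u) [AddCommGroup N] [Module A N] [Module Aᵐᵒᵖ N]
  [SMulCommClass A Aᵐᵒᵖ N] [Module.Finite Aᵐᵒᵖ N]

/-- The functor `- ⊗_A N` on finitely generated right `A`-modules, for an `A`-bimodule `N` which is
finitely generated on the right. -/
noncomputable def tensorFunctor : FGModuleCat.{u} Aᵐᵒᵖ ⥤ FGModuleCat.{u} Aᵐᵒᵖ where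
  obj M := FGModuleCat.of Aᵐᵒᵖ (BalancedTensor A M N)
  map f := FGModuleCat.ofHom (BalancedTensor.map N f.hom.hom)
  map_id M := by
    apply FGModuleCat.hom_ext
    exact BalancedTensor.hom_ext (fun _ _ => rfl)
  map_comp f g := by
    apply FGModuleCat.hom_ext
    exact BalancedTensor.hom_ext (fun _ _ => rfl)

instance : (tensorFunctor A N).Additive where
  map_add {M M' f g} := by
    apply FGModuleCat.hom_ext
    refine BalancedTensor.hom_ext (fun m ν => ?_)
    exact BalancedTensor.add_tmul (f.hom.hom m) (g.hom.hom m) ν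

end

section

variable (k : Type u) [Field k] (A : Type u) [Ring A] [Algebra k A]

/-- The underlying space of the right `A`-module `D Hom_A(M, A)`, where `M` is a right `A`-module and
`D = Hom_k(-, k)`. -/
def NakayamaModule (M : Type u) [AddCommGroup M] [Module Aᵐᵒᵖ M] : Type u :=
  Module.Dual k (M →ₗ[Aᵐᵒᵖ] A)

namespace NakayamaModule

variable {k A}
variable {M M' M'' : Type u} [AddCommGroup M] [Module Aᵐᵒᵖ M] [AddCommGroup M'] [Module Aᵐᵒᵖ M']
  [AddCommGroup M''] [Module Aᵐᵒᵖ M'']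

noncomputable instance : AddCommGroup (NakayamaModule k A M) :=
  inferInstanceAs (AddCommGroup (Module.Dual k (M →ₗ[Aᵐᵒᵖ] A)))

noncomputable instance : Module k (NakayamaModule k A M) :=
  inferInstanceAs (Module k (Module.Dual k (M →ₗ[Aᵐᵒᵖ] A)))

/-- An element of `D Hom_A(M, A)`, viewed as a linear form on `Hom_A(M, A)`. -/
def form (ξ : NakayamaModule k A M) : (M →ₗ[Aᵐᵒᵖ] A) →ₗ[k] k := ξ

/-- The right action of `A` on `D Hom_A(M, A)`: it is given by `(ξ · a) φ = ξ (a φ)`, where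
`(a φ) m = a (φ m)`. -/
noncomputable instance : Module Aᵐᵒᵖ (NakayamaModule k A M) where
  smul a ξ := LinearMap.comp (form ξ)
    (Module.toModuleEnd k (S := A) (M →ₗ[Aᵐᵒᵖ] A) a.unop)
  one_smul ξ := by
    refine LinearMap.ext fun φ => ?_
    exact congrArg (form ξ) (one_smul A φ)
  mul_smul a b ξ := by
    refine LinearMap.ext fun φ => ?_
    exact congrArg (form ξ) (mul_smul b.unop a.unop φ)
  smul_zero a := rfl
  smul_add a ξ η := rfl
  add_smul a b ξ := by
    refine LinearMap.ext fun φ => ?_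
    refine (congrArg (form ξ) (add_smul a.unop b.unop φ)).trans ?_
    exact map_add (form ξ) _ _
  zero_smul ξ := by
    refine LinearMap.ext fun φ => ?_
    refine (congrArg (form ξ) (zero_smul A φ)).trans ?_
    exact map_zero (form ξ)

instance : IsScalarTower k Aᵐᵒᵖ (NakayamaModule k A M) where
  smul_assoc c a ξ := by
    refine LinearMap.ext fun φ => ?_
    refine (congrArg (form ξ) (smul_assoc c a.unop φ)).trans ?_
    exact map_smul (form ξ) _ _

instance [Module.Finite k A] [Module.Finite Aᵐᵒᵖ M] : Module.Finite k (M →ₗ[Aᵐᵒᵖ] A) := by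
  obtain ⟨n, s, hs⟩ := Module.Finite.exists_fin (R := Aᵐᵒᵖ) (M := M)
  let ev : (M →ₗ[Aᵐᵒᵖ] A) →ₗ[k] (Fin n → A) :=
    { toFun := fun φ i => φ (s i)
      map_add' := fun _ _ => rfl
      map_smul' := fun _ _ => rfl }
  refine Module.Finite.of_injective ev (fun φ ψ h => ?_)
  refine LinearMap.ext_on hs ?_
  rintro _ ⟨i, rfl⟩
  exact congrFun h i

instance [Module.Finite k A] [Module.Finite Aᵐᵒᵖ M] :
    Module.Finite Aᵐᵒᵖ (NakayamaModule k A M) := by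
  have : Module.Finite k (NakayamaModule k A M) :=
    inferInstanceAs (Module.Finite k (Module.Dual k (M →ₗ[Aᵐᵒᵖ] A)))
  exact Module.Finite.of_restrictScalars_finite k Aᵐᵒᵖ _

/-- `D Hom_A(f, A)`, i.e. `ξ ↦ (φ ↦ ξ (φ ∘ f))`. -/
noncomputable def map (f : M →ₗ[Aᵐᵒᵖ] M') : NakayamaModule k A M →ₗ[Aᵐᵒᵖ] NakayamaModule k A M' where
  toFun ξ := LinearMap.comp (form ξ) (LinearMap.lcomp k A f)
  map_add' _ _ := rfl
  map_smul' _ _ := rfl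

end NakayamaModule

variable [Module.Finite k A]

/-- The Nakayama functor `D Hom_A(-, A)` on the category of finitely generated right modules over a
finite-dimensional `k`-algebra `A`. -/
noncomputable def nakayama : FGModuleCat.{u} Aᵐᵒᵖ ⥤ FGModuleCat.{u} Aᵐᵒᵖ where
  obj M := FGModuleCat.of Aᵐᵒᵖ (NakayamaModule k A M)
  map f := FGModuleCat.ofHom (NakayamaModule.map f.hom.hom)
  map_id _ := rfl
  map_comp _ _ := rfl

instance : (nakayama k A).Additive where
  map_add {M M' f g} := by
    apply FGModuleCat.hom_ext
    refine LinearMap.ext fun (ξ : NakayamaModule k A M) =>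
      LinearMap.ext fun (φ : M' →ₗ[Aᵐᵒᵖ] A) => ?_
    refine Eq.trans ?_ (map_add ξ.form
      (φ.comp f.hom.hom) (φ.comp g.hom.hom))
    refine congrArg ξ.form ?_
    exact LinearMap.comp_add _ _ _

end

section

variable (k : Type u) [Field k]

lemma isNoetherianRing_op (A : Type u) [Ring A] [Algebra k A] [Module.Finite k A] :
    IsNoetherianRing Aᵐᵒᵖ :=
  have : Module.Finite k Aᵐᵒᵖ := Module.Finite.equiv (MulOpposite.opLinearEquiv k)
  isNoetherian_of_tower k inferInstance

variable (n : ℕ)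

/-- The path algebra over `k` of the quiver `1 → 2 → ⋯ → n` (with vertices indexed by `Fin n`).
This quiver has exactly one path from `i` to `j` if `i ≤ j` and none otherwise, so an element of the
path algebra is a family of coefficients `a i j` with `a i j = 0` unless `i ≤ j`. The product is the
concatenation of paths, `(i → l) * (l → j) = (i → j)`, that is `(a * b) i j = ∑ l, a i l * b l j`.
A right module over it is a representation of the quiver. -/
abbrev PathAlgebra : Type u := IncidenceAlgebra k (Fin n)

instance : Module.Finite k (PathAlgebra k n) := by
  let f : PathAlgebra k n →ₗ[k] (Fin n → Fin n → k) :=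
    { toFun := fun a => a
      map_add' := fun _ _ => rfl
      map_smul' := fun _ _ => rfl }
  exact Module.Finite.of_injective f DFunLike.coe_injective

instance : IsNoetherianRing (PathAlgebra k n)ᵐᵒᵖ :=
  isNoetherianRing_op k (PathAlgebra k n)

/-- The category `𝒜_n` of finite-dimensional right modules over the path algebra of `1 → 2 → ⋯ → n`
(the finite-dimensional modules are the finitely generated ones, as the path algebra is
finite-dimensional). -/
abbrev ModA : Type (u+1) := FGModuleCat.{u} (PathAlgebra k n)ᵐᵒᵖ

/-- The families of scalars `(x i j)` with support in `{(i, j) | i ≥ j}`. -/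
def standardSubmodule : Submodule k (Fin n → Fin n → k) where
  carrier := {x | ∀ i j, ¬ j ≤ i → x i j = 0}
  add_mem' hx hy i j h := by simp [hx i j h, hy i j h]
  zero_mem' _ _ _ := rfl
  smul_mem' c x hx i j h := by simp [hx i j h]

/-- The standard bimodule `N_n` over the path algebra, with support `{(i, j) | i ≥ j}`: the vector space
at the vertex `(i, j)` is a copy of `k` if `i ≥ j` and zero otherwise, and an arrow acts by the
identity of `k` when both of its ends lie in the support (and by zero otherwise). -/
def StandardBimodule : Type u := standardSubmodule k n

namespace StandardBimodule

instance : AddCommGroup (StandardBimodule k n) := inferInstanceAs (AddCommGroup (standardSubmodule k n))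
instance : Module k (StandardBimodule k n) := inferInstanceAs (Module k (standardSubmodule k n))

variable {k n}

instance : CoeFun (StandardBimodule k n) (fun _ => Fin n → Fin n → k) := ⟨fun x => x.1⟩

lemma apply_eq_zero (x : StandardBimodule k n) {i j : Fin n} (h : ¬ j ≤ i) : x i j = 0 := x.2 i j h

@[ext]
lemma ext {x y : StandardBimodule k n} (h : ∀ i j, j ≤ i → x i j = y i j) : x = y := by
  refine Subtype.ext (funext₂ fun i j => ?_)
  by_cases hij : j ≤ i
  · exact h i j hij
  · exact (x.2 i j hij).trans (y.2 i j hij).symm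

@[simp] lemma add_apply (x y : StandardBimodule k n) (i j : Fin n) : (x + y) i j = x i j + y i j := rfl
@[simp] lemma zero_apply (i j : Fin n) : (0 : StandardBimodule k n) i j = 0 := rfl
@[simp] lemma smul_apply (c : k) (x : StandardBimodule k n) (i j : Fin n) : (c • x) i j = c * x i j := rfl

/-- The left action, contravariant in `i`: a path `i → l` maps the component `(l, j)` to the component
`(i, j)`, by the identity of `k` if `l ≥ j` and `i ≥ j`, and by zero otherwise. -/
instance : SMul (PathAlgebra k n) (StandardBimodule k n) where
  smul a x := ⟨fun i j => if j ≤ i then ∑ l, a i l * x l j else 0, fun _ _ h => if_neg h⟩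

/-- The right action, covariant in `j`: a path `l → j` maps the component `(i, l)` to the component
`(i, j)`, by the identity of `k` if `i ≥ l` and `i ≥ j`, and by zero otherwise. -/
instance : SMul (PathAlgebra k n)ᵐᵒᵖ (StandardBimodule k n) where
  smul a x := ⟨fun i j => if j ≤ i then ∑ l, x i l * a.unop l j else 0, fun _ _ h => if_neg h⟩

lemma left_apply (a : PathAlgebra k n) (x : StandardBimodule k n) {i j : Fin n} (h : j ≤ i) :
    (a • x) i j = ∑ l, a i l * x l j := if_pos h

lemma right_apply (a : (PathAlgebra k n)ᵐᵒᵖ) (x : StandardBimodule k n) {i j : Fin n} (h : j ≤ i) :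
    (a • x) i j = ∑ l, x i l * a.unop l j := if_pos h

lemma mul_apply' (a b : PathAlgebra k n) (i j : Fin n) : (a * b) i j = ∑ l, a i l * b l j := by
  rw [IncidenceAlgebra.mul_apply]
  refine Finset.sum_subset (Finset.subset_univ _) (fun l _ hl => ?_)
  rw [Finset.mem_Icc, not_and_or] at hl
  rcases hl with hl | hl
  · rw [IncidenceAlgebra.apply_eq_zero_of_not_le hl, zero_mul]
  · rw [IncidenceAlgebra.apply_eq_zero_of_not_le hl, mul_zero]

instance : Module (PathAlgebra k n) (StandardBimodule k n) where
  one_smul x := by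
    ext i j h
    rw [left_apply _ _ h]
    simp [IncidenceAlgebra.one_apply]
  mul_smul a b x := by
    ext i j h
    rw [left_apply _ _ h, left_apply _ _ h]
    have h₁ : ∀ l, a i l * (b • x) l j = ∑ m, a i l * (b l m * x m j) := by
      intro l
      by_cases hl : i ≤ l
      · rw [left_apply _ _ (h.trans hl), Finset.mul_sum]
      · simp [IncidenceAlgebra.apply_eq_zero_of_not_le hl]
    simp only [h₁, mul_apply', Finset.sum_mul]
    rw [Finset.sum_comm]
    simp only [mul_assoc]
  smul_zero a := by ext i j h; rw [left_apply _ _ h]; simp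
  smul_add a x y := by
    ext i j h
    rw [add_apply, left_apply _ _ h, left_apply _ _ h, left_apply _ _ h]
    simp [mul_add, Finset.sum_add_distrib]
  add_smul a b x := by
    ext i j h
    rw [add_apply, left_apply _ _ h, left_apply _ _ h, left_apply _ _ h]
    simp [add_mul, Finset.sum_add_distrib]
  zero_smul x := by ext i j h; rw [left_apply _ _ h]; simp

instance : Module (PathAlgebra k n)ᵐᵒᵖ (StandardBimodule k n) where
  one_smul x := by
    ext i j h
    rw [right_apply _ _ h]
    simp [IncidenceAlgebra.one_apply]
  mul_smul a b x := by
    ext i j h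
    rw [right_apply _ _ h, right_apply _ _ h]
    have h₁ : ∀ l, (b • x) i l * a.unop l j = ∑ m, x i m * b.unop m l * a.unop l j := by
      intro l
      by_cases hl : l ≤ j
      · rw [right_apply _ _ (hl.trans h), Finset.sum_mul]
      · simp [IncidenceAlgebra.apply_eq_zero_of_not_le hl]
    simp only [h₁, MulOpposite.unop_mul, mul_apply', Finset.mul_sum]
    rw [Finset.sum_comm]
    simp only [mul_assoc]
  smul_zero a := by ext i j h; rw [right_apply _ _ h]; simp
  smul_add a x y := by
    ext i j h
    rw [add_apply, right_apply _ _ h, right_apply _ _ h, right_apply _ _ h]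
    simp [add_mul, Finset.sum_add_distrib]
  add_smul a b x := by
    ext i j h
    rw [add_apply, right_apply _ _ h, right_apply _ _ h, right_apply _ _ h]
    simp [mul_add, Finset.sum_add_distrib]
  zero_smul x := by ext i j h; rw [right_apply _ _ h]; simp

instance : SMulCommClass (PathAlgebra k n) (PathAlgebra k n)ᵐᵒᵖ (StandardBimodule k n) where
  smul_comm a b x := by
    ext i j h
    rw [left_apply _ _ h, right_apply _ _ h]
    have h₁ : ∀ l, a i l * (b • x) l j = ∑ m, a i l * (x l m * b.unop m j) := by
      intro l
      by_cases hl : i ≤ l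
      · rw [right_apply _ _ (h.trans hl), Finset.mul_sum]
      · simp [IncidenceAlgebra.apply_eq_zero_of_not_le hl]
    have h₂ : ∀ m, (a • x) i m * b.unop m j = ∑ l, a i l * x l m * b.unop m j := by
      intro m
      by_cases hm : m ≤ j
      · rw [left_apply _ _ (hm.trans h), Finset.sum_mul]
      · simp [IncidenceAlgebra.apply_eq_zero_of_not_le hm]
    simp only [h₁, h₂]
    rw [Finset.sum_comm]
    simp only [mul_assoc]

instance : IsScalarTower k (PathAlgebra k n)ᵐᵒᵖ (StandardBimodule k n) where
  smul_assoc c a x := by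
    ext i j h
    rw [smul_apply, right_apply _ _ h, right_apply _ _ h, Finset.mul_sum]
    refine Finset.sum_congr rfl (fun l _ => ?_)
    change x i l * (c * a.unop l j) = _
    ring

instance : Module.Finite (PathAlgebra k n)ᵐᵒᵖ (StandardBimodule k n) :=
  have : Module.Finite k (StandardBimodule k n) :=
    inferInstanceAs (Module.Finite k (standardSubmodule k n))
  Module.Finite.of_restrictScalars_finite k (PathAlgebra k n)ᵐᵒᵖ _

end StandardBimodule
end

end TypeAQuiver

/-! The two functors are already isomorphic before deriving, on all finitely generated modules. The
trace pairing `(ν, a) ↦ tr (ν a)` between lower and upper triangular matrices is perfect and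
compatible with both actions, so `N_n` is the bimodule `Hom_k(A, k)`. The map `m ⊗ ν ↦ (φ ↦ ⟨ν, φ
m⟩)` from `M ⊗_A N` to `D Hom_A(M, A)` is then bijective. Injectivity comes from the adjunction
`Hom_k(M ⊗_A N, k) = Hom_A(M, Hom_k(N, k)) = Hom_A(M, A)`, and surjectivity from a finite generating
set of `M` (`toNakayama_injective`, `toNakayama_surjective`). Isomorphic functors have isomorphic
derived functors (`leftDerivedIso`).

What remains is the existence of the derived functors on bounded complexes. The path algebra is
hereditary: the nonzero submodules of the module of row vectors are the projectives `e_i A`, and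
this passes to finite products and submodules, hence to free modules of finite rank. So a bounded
complex has a resolution `P` by a bounded complex of projectives. Maps out of `P` in the derived
category are homotopy classes of maps of complexes, and an additive functor `F` preserves
homotopies; hence `F P` computes a pointwise Kan extension (`hasLeftDerived_of_hereditary`). -/

namespace CategoryTheory.Functor

open Limits

/-! ### Pointwise Kan extensions from lifting of morphisms -/

variable {C D H : Type*} [Category* C] [Category* D] [Category* H] (L : C ⥤ D) (F : C ⥤ H)

/-- A functor `F` has a pointwise right Kan extension along `L` at `X` when `X` is isomorphic to
`L.obj P`, where morphisms out of `L.obj P` lift to morphisms out of `P` in such a way that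
the image of the lift under `F` is well defined. -/
lemma hasPointwiseRightKanExtensionAt_of_lifts {X : D} {P : C} (e : X ≅ L.obj P)
    (hL : ∀ ⦃Y : C⦄ (f : L.obj P ⟶ L.obj Y), ∃ g : P ⟶ Y, L.map g = f)
    (hF : ∀ ⦃Y : C⦄ (g g' : P ⟶ Y), L.map g = L.map g' → F.map g = F.map g') :
    L.HasPointwiseRightKanExtensionAt F X := by
  choose l hl using fun j : StructuredArrow X L => hL (e.inv ≫ j.hom)
  let c : Cone (StructuredArrow.proj X L ⋙ F) :=
    { pt := F.obj P
      π :=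
        { app j := F.map (l j)
          naturality i j φ := by
            refine (Category.id_comp _).trans ((hF (l j) (l i ≫ φ.right) ?_).trans (F.map_comp _ _))
            rw [L.map_comp, hl, hl, Category.assoc, StructuredArrow.w] } }
  -- The arrow `j₀` is weakly initial: each `l j` is a map `j₀ ⟶ j`. Hence a cone is determined by
  -- its component at `j₀`, where the leg of `c` is the identity.
  let j₀ : StructuredArrow X L := StructuredArrow.mk e.hom
  have h₀ : F.map (l j₀) = 𝟙 _ := by
    rw [← F.map_id]
    refine hF _ _ ?_
    rw [hl, L.map_id]
    exact e.inv_hom_id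
  refine ⟨⟨⟨c, { lift s := s.π.app j₀, fac s j := ?_, uniq s m hm := ?_ }⟩⟩⟩
  · have := s.π.naturality (StructuredArrow.homMk (l j) (by
      dsimp [j₀]; rw [hl, e.hom_inv_id_assoc]) : j₀ ⟶ j)
    dsimp at this
    rw [Category.id_comp] at this
    exact this.symm
  · rw [← hm j₀]
    exact ((congrArg (m ≫ ·) h₀).trans (Category.comp_id _)).symm

end CategoryTheory.Functor

/-! ### Bounded projective resolutions and left derived functors -/

namespace BoundedDerived

open CategoryTheory Limits

variable {C : Type*} [Category* C] [Abelian C]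

/-- Covering zero objects by zero objects keeps degreewise covers of bounded complexes bounded; an
arbitrary choice of projective cover need not. -/
lemma exists_projective_epi_of_isZero [EnoughProjectives C] (X : C) :
    ∃ (P : C) (p : P ⟶ X), Projective P ∧ Epi p ∧ (IsZero X → IsZero P) := by
  by_cases hX : IsZero X
  · exact ⟨X, 𝟙 X, Projective.of_iso hX.isoZero.symm inferInstance, inferInstance, id⟩
  · exact ⟨_, Projective.π X, inferInstance, inferInstance, fun h => (hX h).elim⟩

lemma isKProjective_of_bounded {P : CochainComplex C ℤ} (hP : bounded C P)
    (h : ∀ i, Projective (P.X i)) : P.IsKProjective := by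
  obtain ⟨-, b, _⟩ := hP
  exact CochainComplex.isKProjective_of_projective P b

lemma bounded_mappingCone {K L : CochainComplex C ℤ} (f : K ⟶ L) (hK : bounded C K)
    (hL : bounded C L) : bounded C (CochainComplex.mappingCone f) := by
  obtain ⟨⟨a, _⟩, ⟨b, _⟩⟩ := hK
  obtain ⟨⟨a', _⟩, ⟨b', _⟩⟩ := hL
  exact ⟨⟨min (a - 1) a', CochainComplex.isStrictlyGE_mappingCone f a a' _ (by simp) (by simp)⟩,
    ⟨_, isStrictlyLE_mappingCone C f b b'⟩⟩

lemma bounded_of_isZero {K L : CochainComplex C ℤ} (hL : bounded C L)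
    (h : ∀ i, IsZero (L.X i) → IsZero (K.X i)) : bounded C K := by
  obtain ⟨⟨a, _⟩, ⟨b, _⟩⟩ := hL
  exact ⟨⟨a, (CochainComplex.isStrictlyGE_iff _ _).2
      fun i hi => h i (L.isZero_of_isStrictlyGE a i hi)⟩,
    ⟨b, (CochainComplex.isStrictlyLE_iff _ _).2
      fun i hi => h i (L.isZero_of_isStrictlyLE b i hi)⟩⟩

lemma projective_mappingCone_X {K L : CochainComplex C ℤ} (f : K ⟶ L)
    (hK : ∀ i, Projective (K.X i)) (hL : ∀ i, Projective (L.X i)) (i : ℤ) :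
    Projective ((CochainComplex.mappingCone f).X i) :=
  have := hK
  have := hL
  Projective.of_iso (HomologicalComplex.homotopyCofiber.XIsoBiprod f i (i + 1) rfl).symm
    inferInstance

/-- A bounded complex receives a degreewise epimorphism from a bounded complex of projectives. -/
lemma exists_bounded_projective_epi [EnoughProjectives C] {X : CochainComplex C ℤ}
    (hX : bounded C X) :
    ∃ (Z : CochainComplex C ℤ) (p : Z ⟶ X), bounded C Z ∧ (∀ i, Projective (Z.X i)) ∧
      ∀ i, Epi (p.f i) := by
  choose P p hP hp hP₀ using fun i => exists_projective_epi_of_isZero (X.X i)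
  -- The cover is the cone of `𝟙 T`, whose degree `i` term is `T^{i+1} ⊕ T^i = P_i ⊕ P_{i-1}`; the
  -- shift in `T` is chosen so that `P_i` sits in degree `i`.
  let T : CochainComplex C ℤ := { X i := P (i - 1), d _ _ := 0 }
  have hT : bounded C T := by
    obtain ⟨⟨a, _⟩, ⟨b, _⟩⟩ := hX
    exact ⟨⟨a + 1, (CochainComplex.isStrictlyGE_iff _ _).2
        fun i hi => hP₀ _ (X.isZero_of_isStrictlyGE a _ (by lia))⟩,
      ⟨b + 1, (CochainComplex.isStrictlyLE_iff _ _).2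
        fun i hi => hP₀ _ (X.isZero_of_isStrictlyLE b _ (by lia))⟩⟩
  -- A map out of the cone of `𝟙 T` is a map `β : T ⟶ X` with a null-homotopy `α`. Any degree `-1`
  -- cochain `α` will do, with `β = δ α`, so the `p i` need no compatibility with the differential
  -- of `X`.
  let α : CochainComplex.HomComplex.Cochain T X (-1) :=
    .mk fun i j hij => p (i - 1) ≫ (X.XIsoOfEq (by lia)).hom
  let β : CochainComplex.HomComplex.Cocycle T X 0 :=
    .mk (CochainComplex.HomComplex.δ (-1) 0 α) 1 rfl (CochainComplex.HomComplex.δ_δ _ _ _ _)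
  let π : CochainComplex.mappingCone (𝟙 T) ⟶ X :=
    CochainComplex.mappingCone.desc (𝟙 T) α β.homOf (by simp [β])
  refine ⟨_, π, bounded_mappingCone _ hT hT,
    projective_mappingCone_X _ (fun i => hP _) (fun i => hP _), fun i => ?_⟩
  -- Restricted to the summand `P_i`, the map `π` is `p i` up to identification of indices; this
  -- already makes it an epimorphism.
  have h : (CochainComplex.mappingCone.inl (𝟙 T)).v (i + 1) i (by lia) ≫ π.f i =
      p (i + 1 - 1) ≫ (X.XIsoOfEq (by lia)).hom := by
    rw [CochainComplex.mappingCone.inl_v_desc_f]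
    rfl
  have hpi : Epi (p (i + 1 - 1)) := hp _
  have : Epi ((CochainComplex.mappingCone.inl (𝟙 T)).v (i + 1) i (by lia) ≫ π.f i) := by
    rw [h]
    infer_instance
  exact epi_of_epi ((CochainComplex.mappingCone.inl (𝟙 T)).v (i + 1) i _) (π.f i)

/-- In a hereditary abelian category with enough projectives, every bounded complex has a
bounded projective resolution. -/
lemma exists_bounded_projective_resolution [EnoughProjectives C]
    (hC : ∀ ⦃K P : C⦄ (i : K ⟶ P), Mono i → Projective P → Projective K)
    {X : CochainComplex C ℤ} (hX : bounded C X) :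
    ∃ (P : CochainComplex C ℤ) (p : P ⟶ X), bounded C P ∧ (∀ i, Projective (P.X i)) ∧
      QuasiIso p := by
  obtain ⟨Z, q, hZ, hZ', _⟩ := exists_bounded_projective_epi hX
  have : Epi q := HomologicalComplex.epi_of_epi_f _ (by assumption)
  have hι (i : ℤ) : Mono ((kernel.ι q).f i) := inferInstance
  -- The kernel of `q` is a subobject of projectives in each degree, hence projective. The cone of
  -- its inclusion is therefore a complex of projectives quasi-isomorphic to `X`.
  let S := ShortComplex.mk (kernel.ι q) q (kernel.condition q)
  have hS : S.ShortExact := { exact := S.exact_of_f_is_kernel (kernelIsKernel q) }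
  have hK : bounded C (kernel q) := bounded_of_isZero hZ fun i hi => hi.of_mono ((kernel.ι q).f i)
  exact ⟨_, CochainComplex.mappingCone.descShortComplex S, bounded_mappingCone _ hK hZ,
    projective_mappingCone_X _ (fun i => hC _ (hι i) (hZ' i)) hZ',
    CochainComplex.mappingCone.quasiIso_descShortComplex hS⟩

variable [HasDerivedCategory.{w} C]

/-- Maps out of a K-projective complex are the same in the homotopy category as in the derived
category. This and the next lemma are the injective and surjective halves, read at the level of
complexes. -/
lemma Q_map_eq_iff_of_isKProjective {P Y : Complexes C} [P.obj.IsKProjective] (f g : P ⟶ Y) :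
    (Q C).map f = (Q C).map g ↔ Nonempty (_root_.Homotopy f.hom g.hom) := by
  refine ⟨fun h => ⟨HomotopyCategory.homotopyOfEq _ _
    ((CochainComplex.IsKProjective.Qh_map_bijective P.obj _).1 ?_)⟩,
    fun ⟨h⟩ => by ext; exact DerivedCategory.Q_map_eq_of_homotopy _ h⟩
  have h' : DerivedCategory.Q.map f.hom = DerivedCategory.Q.map g.hom :=
    congrArg (·.hom) h
  have := congr(((DerivedCategory.quotientCompQhIso C).hom.app P.obj) ≫ $h')
  rw [← NatTrans.naturality, ← NatTrans.naturality] at this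
  exact (cancel_mono _).1 this

lemma Q_map_surjective_of_isKProjective {P Y : Complexes C} [P.obj.IsKProjective]
    (f : (Q C).obj P ⟶ (Q C).obj Y) : ∃ g : P ⟶ Y, (Q C).map g = f := by
  obtain ⟨f : DerivedCategory.Q.obj P.obj ⟶ DerivedCategory.Q.obj Y.obj, rfl⟩ :=
    ObjectProperty.homMk_surjective f
  let e := DerivedCategory.quotientCompQhIso C
  obtain ⟨g, hg⟩ := (CochainComplex.IsKProjective.Qh_map_bijective P.obj _).2
    (e.hom.app P.obj ≫ f ≫ e.inv.app Y.obj)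
  obtain ⟨g, rfl⟩ := (HomotopyCategory.quotient _ _).map_surjective g
  refine ⟨ObjectProperty.homMk g, ?_⟩
  ext
  have := e.hom.naturality g
  refine (cancel_epi (e.hom.app P.obj)).1 (this.symm.trans ?_)
  refine (congrArg (· ≫ e.hom.app Y.obj) hg).trans ?_
  simp only [Category.assoc, Iso.inv_hom_id_app, Category.comp_id]
  rfl

variable {D : Type*} [Category* D] [Abelian D] [HasDerivedCategory.{w} D]

/-- An additive functor from a hereditary abelian category with enough projectives has a total
left derived functor on the bounded derived category. -/
theorem hasLeftDerived_of_hereditary [EnoughProjectives C]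
    (hC : ∀ ⦃K P : C⦄ (i : K ⟶ P), Mono i → Projective P → Projective K)
    (F : C ⥤ D) [F.Additive] : HasLeftDerived F := by
  have : (mapComplexes F ⋙ Q D).HasPointwiseLeftDerivedFunctor (quasiIso C) := fun X => by
    rw [Functor.hasPointwiseLeftDerivedFunctorAt_iff _ (Q C)]
    obtain ⟨P, p, hP, hP', hp⟩ := exists_bounded_projective_resolution hC X.property
    have := isKProjective_of_bounded hP hP'
    let P' : Complexes C := ⟨P, hP⟩
    let p' : P' ⟶ X := ObjectProperty.homMk p
    have : IsIso ((Q C).map p') := (isIso_Q_map_iff C p').2 hp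
    have : P'.obj.IsKProjective := by assumption
    -- Two lifts of one derived map out of `P` are homotopic, and `F`, being additive, carries the
    -- homotopy along.
    refine Functor.hasPointwiseRightKanExtensionAt_of_lifts (Q C) _ (asIso ((Q C).map p')).symm
      (fun Y f => Q_map_surjective_of_isKProjective f) (fun Y f g h => ?_)
    obtain ⟨h⟩ := (Q_map_eq_iff_of_isKProjective f g).1 h
    ext
    exact DerivedCategory.Q_map_eq_of_homotopy _ (F.mapHomotopy h)
  infer_instance

/-- Isomorphic additive functors have isomorphic total left derived functors. -/
noncomputable def leftDerivedIso {F G : C ⥤ D} [F.Additive] [G.Additive] [HasLeftDerived F]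
    [HasLeftDerived G] (e : F ≅ G) : leftDerived F ≅ leftDerived G := by
  unfold leftDerived
  exact Functor.leftDerivedNatIso _ _
    ((mapComplexes F ⋙ Q D).totalLeftDerivedCounit (Q C) (quasiIso C))
    ((mapComplexes G ⋙ Q D).totalLeftDerivedCounit (Q C) (quasiIso C)) (quasiIso C)
    (Functor.isoWhiskerRight (NatIso.ofComponents
      (fun K => (bounded D).isoMk ((NatIso.mapHomologicalComplex e _).app K.obj))
      (fun f => by ext : 1; exact (NatIso.mapHomologicalComplex e _).hom.naturality f.hom)) (Q D))

end BoundedDerived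

/-! ### Projectives among finitely generated modules -/

namespace FGModuleCat

open CategoryTheory

variable {R : Type u} [Ring R] 

lemma surjective_of_epi [IsNoetherianRing R] {M N : FGModuleCat.{u} R} (f : M ⟶ N) [Epi f] :
    Function.Surjective f.hom.hom := by
  have : Epi ((forget₂ (FGModuleCat.{u} R) (ModuleCat.{u} R)).map f) := inferInstance
  exact (ModuleCat.epi_iff_surjective _).1 this

lemma injective_of_mono [IsNoetherianRing R] {M N : FGModuleCat.{u} R} (f : M ⟶ N) [Mono f] :
    Function.Injective f.hom.hom := by
  have : Mono ((forget₂ (FGModuleCat.{u} R) (ModuleCat.{u} R)).map f) := inferInstance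
  exact (ModuleCat.mono_iff_injective _).1 this

lemma epi_of_surjective {M N : FGModuleCat.{u} R} (f : M ⟶ N)
    (hf : Function.Surjective f.hom.hom) : Epi f :=
  (forget₂ (FGModuleCat.{u} R) (ModuleCat.{u} R)).epi_of_epi_map
    ((ModuleCat.epi_iff_surjective _).2 hf)

lemma projective_of_moduleProjective [IsNoetherianRing R] (P : FGModuleCat.{u} R)
    [Module.Projective R P] : Projective P where
  factors {E X} f e _ := by
    obtain ⟨g, hg⟩ := Module.projective_lifting_property e.hom.hom f.hom.hom (surjective_of_epi e)
    exact ⟨ofHom g, hom_ext hg⟩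

instance [IsNoetherianRing R] : EnoughProjectives (FGModuleCat.{u} R) where
  presentation M := by
    obtain ⟨n, f, hf⟩ := Module.Finite.exists_fin' R M
    have : Module.Projective R (of R (Fin n → R)) :=
      inferInstanceAs (Module.Projective R (Fin n → R))
    exact ⟨{ p := of R (Fin n → R)
             projective := projective_of_moduleProjective _
             f := ofHom f
             epi := epi_of_surjective _ hf }⟩

lemma projective_of_mono [IsNoetherianRing R]
    (hR : ∀ (n : ℕ) (W : Submodule R (Fin n → R)), Module.Projective R W)
    {M P : FGModuleCat.{u} R} (i : M ⟶ P) [Mono i] [Projective P] : Projective M := by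
  obtain ⟨n, f, hf⟩ := Module.Finite.exists_fin' R P
  have : Epi (ofHom f : of R (Fin n → R) ⟶ P) := epi_of_surjective _ hf
  -- A section of `R^n ↠ P`. Composed with `i` it embeds `M` in `R^n`, so `M` is isomorphic to a
  -- submodule of a free module.
  let s := Projective.factorThru (𝟙 P) (ofHom f : of R (Fin n → R) ⟶ P)
  have : Mono s := mono_of_mono_fac (Projective.factorThru_comp (𝟙 P) (ofHom f : of R (Fin n → R) ⟶ P))
  have := hR n (LinearMap.range (i ≫ s).hom.hom)
  have : Module.Projective R M :=
    .of_equiv (LinearEquiv.ofInjective _ (injective_of_mono (i ≫ s))).symm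
  exact projective_of_moduleProjective M

end FGModuleCat

/-! ### Modules whose submodules are all projective -/

section Hereditary

variable {R : Type*} [Ring R]

/-- A module all of whose submodules are projective. -/
def Module.SubmodulesProjective (R M : Type*) [Ring R] [AddCommGroup M] [Module R M] : Prop :=
  ∀ W : Submodule R M, Module.Projective R W

namespace Module.SubmodulesProjective

variable {M N : Type*} [AddCommGroup M] [Module R M] [AddCommGroup N] [Module R N]

lemma of_injective (hN : SubmodulesProjective R N) (f : M →ₗ[R] N) (hf : Function.Injective f) :
    SubmodulesProjective R M := fun W =>
  have := hN (W.map f)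
  .of_equiv (W.equivMapOfInjective f hf).symm

/-- The projection of `W` to `N` has projective image, so `W` splits as kernel plus image; the
kernel embeds in `M` by the first coordinate. -/
lemma prod (hM : SubmodulesProjective R M) (hN : SubmodulesProjective R N) :
    SubmodulesProjective R (M × N) := fun W => by
  let f : W →ₗ[R] N := (LinearMap.snd R M N).comp W.subtype
  have h₁ := hN (LinearMap.range f)
  have h₂ : Module.Projective R (LinearMap.ker f) := by
    have := of_injective (M := LinearMap.ker f) hM
      ((LinearMap.fst R M N).comp (W.subtype.comp (LinearMap.ker f).subtype)) (fun x y h => ?_) ⊤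
    · exact .of_equiv Submodule.topEquiv
    have hx : x.1.1.2 = 0 := x.2
    have hy : y.1.1.2 = 0 := y.2
    exact Subtype.ext (Subtype.ext (Prod.ext h (hx.trans hy.symm)))
  obtain ⟨s, hs⟩ := Module.projective_lifting_property f.rangeRestrict LinearMap.id
    f.surjective_rangeRestrict
  have hs' (y) : f (s y) = y := congrArg Subtype.val (LinearMap.congr_fun hs y)
  -- The splitting is `w ↦ (w - s (f w), f w)`, with inverse `(u, v) ↦ u + s v`.
  refine .of_split (P := W) (M := LinearMap.ker f × LinearMap.range f)
    (LinearMap.prod (LinearMap.codRestrict _ (LinearMap.id - s.comp f.rangeRestrict) fun x => ?_)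
      f.rangeRestrict) (LinearMap.coprod (LinearMap.ker f).subtype s) ?_
  · simp [hs']
  · ext x : 1
    simp

lemma pi_fin (hM : SubmodulesProjective R M) : ∀ n : ℕ, SubmodulesProjective R (Fin n → M)
  | 0 => fun W => inferInstance
  | n + 1 => of_injective (hM.prod (pi_fin hM n))
      (LinearMap.prod (LinearMap.proj 0) (LinearMap.funLeft R M Fin.succ)) fun x y h => by
        refine funext (Fin.cases (congrArg Prod.fst h) fun i => ?_)
        exact congrFun (congrArg Prod.snd h) i

end Module.SubmodulesProjective

end Hereditary

/-! ### The path algebra is hereditary -/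

namespace TypeAQuiver

variable (k : Type u) [Field k] (n : ℕ)

/-- The row vectors of length `n`, as a right module over the path algebra of
`1 → 2 → ⋯ → n`. -/
def RowModule : Type u := Fin n → k

namespace RowModule

instance : AddCommGroup (RowModule k n) := inferInstanceAs (AddCommGroup (Fin n → k))

variable {k n}

instance : Module (PathAlgebra k n)ᵐᵒᵖ (RowModule k n) where
  smul a x := fun j => ∑ l, x l * a.unop l j
  one_smul x := by
    funext j
    change ∑ l, x l * (1 : PathAlgebra k n) l j = x j
    simp only [IncidenceAlgebra.one_apply, mul_ite, mul_one, mul_zero]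
    exact (Finset.sum_ite_eq' Finset.univ j (show Fin n → k from x)).trans (if_pos (Finset.mem_univ j))
  mul_smul a b x := by
    funext j
    change ∑ l, x l * (b.unop * a.unop) l j = ∑ l, (∑ m, x m * b.unop m l) * a.unop l j
    simp only [StandardBimodule.mul_apply', Finset.mul_sum, Finset.sum_mul, mul_assoc]
    rw [Finset.sum_comm]
  smul_zero a := by
    funext j
    change ∑ l, (0 : k) * a.unop l j = 0
    simp
  smul_add a x y := by
    funext j
    change ∑ l, (x l + y l) * a.unop l j = ∑ l, x l * a.unop l j + ∑ l, y l * a.unop l j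
    simp [add_mul, Finset.sum_add_distrib]
  add_smul a b x := by
    funext j
    change ∑ l, x l * (a.unop l j + b.unop l j) = ∑ l, x l * a.unop l j + ∑ l, x l * b.unop l j
    simp [mul_add, Finset.sum_add_distrib]
  zero_smul x := by
    funext j
    change ∑ l, x l * (0 : k) = 0
    simp

lemma smul_apply (a : (PathAlgebra k n)ᵐᵒᵖ) (x : RowModule k n) (j : Fin n) :
    (a • x) j = ∑ l, x l * a.unop l j := rfl

variable (k n) in
/-- The `i`-th row of an element of the path algebra. -/
def row (i : Fin n) : (PathAlgebra k n)ᵐᵒᵖ →ₗ[(PathAlgebra k n)ᵐᵒᵖ] RowModule k n where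
  toFun a := fun j => a.unop i j
  map_add' _ _ := rfl
  map_smul' a b := funext fun j => StandardBimodule.mul_apply' b.unop a.unop i j

/-- The element of the path algebra with a single nonzero row, the `i`-th one. -/
def single (i : Fin n) (x : RowModule k n) (hx : ∀ j < i, x j = 0) : PathAlgebra k n where
  toFun l j := if l = i then x j else 0
  eq_zero_of_not_le' l j h := by
    split_ifs with hl
    · exact hx j (by subst hl; exact not_le.1 h)
    · rfl

/-- A nonzero submodule `W` consists of all rows vanishing before some index `i`, the least index at
which an element of `W` is nonzero. It is thus a copy of the direct summand `e_i A` of `A`. -/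
lemma submodulesProjective :
    Module.SubmodulesProjective (PathAlgebra k n)ᵐᵒᵖ (RowModule k n) := fun W => by
  by_cases hW : W = ⊥
  · subst hW; infer_instance
  have hex : ∃ i, ∃ x ∈ W, x i ≠ 0 := by
    obtain ⟨x, hx, hx₀⟩ := W.ne_bot_iff.1 hW
    obtain ⟨i, hi⟩ := Function.ne_iff.1 hx₀
    exact ⟨i, x, hx, hi⟩
  obtain ⟨i, ⟨x, hx, hxi⟩, hmin⟩ := WellFounded.has_min (wellFounded_lt (α := Fin n))
    {i | ∃ x ∈ W, x i ≠ 0} hex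
  have hlt (y) (hy : y ∈ W) (j) (hj : j < i) : y j = 0 := by
    by_contra h
    exact hmin j ⟨y, hy, h⟩ hj
  have hmem (y : RowModule k n) (hy : ∀ j < i, y j = 0) : y ∈ W := by
    -- Multiplying `x` by the matrix whose only nonzero row is the `i`-th, equal to `x_i⁻¹ y`, gives
    -- `y`. This matrix is upper triangular because `y` vanishes before `i`.
    have : y = MulOpposite.op (single i (fun j => (x i)⁻¹ * y j)
        fun j hj => by
          rw [hy j hj, mul_zero]) • x := by
      funext j
      rw [smul_apply]
      change y j = ∑ l, x l * if l = i then (x i)⁻¹ * y j else 0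
      simp [hxi]
    rw [this]
    exact W.smul_mem _ hx
  let s : W →ₗ[(PathAlgebra k n)ᵐᵒᵖ] (PathAlgebra k n)ᵐᵒᵖ :=
    { toFun y := MulOpposite.op (single i y.1 (hlt y.1 y.2))
      map_add' y z := by
        refine MulOpposite.unop_injective (DFunLike.coe_injective (funext₂ fun l j => ?_))
        change (if l = i then y.1 j + z.1 j else 0) =
          (if l = i then y.1 j else 0) + if l = i then z.1 j else 0
        split_ifs <;> simp
      map_smul' a y := by
        refine MulOpposite.unop_injective (DFunLike.coe_injective (funext₂ fun l j => ?_))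
        change (if l = i then ∑ m, y.1 m * a.unop m j else 0) =
          (single i y.1 (hlt y.1 y.2) * a.unop) l j
        rw [StandardBimodule.mul_apply']
        change _ = ∑ m, (if l = i then y.1 m else 0) * a.unop m j
        split_ifs <;> simp }
  -- Taking the `i`-th row is a retraction of `s`, so `W` is a direct summand of `A`.
  refine .of_split s (LinearMap.codRestrict W (row k n i) fun a => hmem _ fun j hj =>
    IncidenceAlgebra.apply_eq_zero_of_not_le (not_le.2 hj) _) ?_
  ext y : 2
  exact funext fun j => if_pos rfl

end RowModule

/-- A matrix is the tuple of its rows, and right multiplication acts on each row separately, so `A`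
embeds in a finite power of `RowModule`. -/
lemma submodulesProjective_pathAlgebra :
    Module.SubmodulesProjective (PathAlgebra k n)ᵐᵒᵖ (PathAlgebra k n)ᵐᵒᵖ :=
  .of_injective (RowModule.submodulesProjective.pi_fin n) (LinearMap.pi (RowModule.row k n))
    fun _ _ h => MulOpposite.unop_injective (DFunLike.coe_injective h)

end TypeAQuiver

/-! ### The standard bimodule is dual to the path algebra -/

namespace TypeAQuiver

open CategoryTheory

variable {k : Type u} [Field k] {n : ℕ}

namespace StandardBimodule

variable (k n) in
/-- The trace pairing `(ν, a) ↦ tr (ν a)` between the standard bimodule and the path algebra. -/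
def pairing : StandardBimodule k n →ₗ[k] PathAlgebra k n →ₗ[k] k :=
  LinearMap.mk₂ k (fun ν a => ∑ i, ∑ j, ν i j * a j i)
    (fun ν ν' a => by simp [add_mul, Finset.sum_add_distrib])
    (fun c ν a => by simp [Finset.mul_sum, mul_assoc])
    (fun ν a b => by simp [mul_add, Finset.sum_add_distrib])
    (fun c ν a => by simp [Finset.mul_sum, mul_left_comm])

lemma pairing_apply (ν : StandardBimodule k n) (a : PathAlgebra k n) :
    pairing k n ν a = ∑ i, ∑ j, ν i j * a j i := rfl

/-- This is `tr ((ν a) b) = tr (ν (a b))`. The truncation to `j ≤ i` in the action is invisible to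
the trace, since `b j i` vanishes elsewhere. -/
lemma pairing_op_smul (ν : StandardBimodule k n) (a b : PathAlgebra k n) :
    pairing k n (MulOpposite.op a • ν) b = pairing k n ν (a * b) := by
  have h (i j) : (MulOpposite.op a • ν) i j * b j i = ∑ l, ν i l * a l j * b j i := by
    by_cases hij : j ≤ i
    · rw [right_apply _ _ hij, Finset.sum_mul, MulOpposite.unop_op]
    · simp [IncidenceAlgebra.apply_eq_zero_of_not_le hij]
  simp only [pairing_apply, h, mul_apply', Finset.mul_sum, mul_assoc]
  exact Finset.sum_congr rfl fun i _ => Finset.sum_comm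

/-- This is cyclicity of the trace, `tr ((a ν) b) = tr (ν (b a))`, again with an invisible
truncation. -/
lemma pairing_smul (ν : StandardBimodule k n) (a b : PathAlgebra k n) :
    pairing k n (a • ν) b = pairing k n ν (b * a) := by
  have h (i j) : (a • ν) i j * b j i = ∑ l, ν l j * (b j i * a i l) := by
    by_cases hij : j ≤ i
    · rw [left_apply _ _ hij, Finset.sum_mul]
      exact Finset.sum_congr rfl fun _ _ => by ring
    · simp [IncidenceAlgebra.apply_eq_zero_of_not_le hij]
  simp only [pairing_apply, h, mul_apply', Finset.mul_sum]
  rw [Finset.sum_comm]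
  simp only [fun j => Finset.sum_comm (s := Finset.univ) (t := Finset.univ)
    (f := fun i l : Fin n => ν l j * (b j i * a i l))]
  rw [Finset.sum_comm]

/-- The matrix unit of the path algebra given by the path `i → j`. -/
def path (i j : Fin n) (h : i ≤ j) : PathAlgebra k n where
  toFun l m := if l = i ∧ m = j then 1 else 0
  eq_zero_of_not_le' l m hlm := if_neg fun h' => hlm (by rwa [h'.1, h'.2])

/-- The basis vector of the standard bimodule at the vertex `(i, j)`. -/
def unit (i j : Fin n) (h : j ≤ i) : StandardBimodule k n :=
  ⟨fun l m => if l = i ∧ m = j then 1 else 0, fun l m hlm => if_neg fun h' => hlm (by rwa [h'.1, h'.2])⟩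

lemma pairing_path (ν : StandardBimodule k n) (i j : Fin n) (h : i ≤ j) :
    pairing k n ν (path i j h) = ν j i := by
  change ∑ l, ∑ m, ν l m * (if m = i ∧ l = j then 1 else 0) = ν j i
  simp [ite_and]

lemma pairing_unit (a : PathAlgebra k n) (i j : Fin n) (h : j ≤ i) :
    pairing k n (unit i j h) a = a j i := by
  change ∑ l, ∑ m, (if l = i ∧ m = j then 1 else 0) * a m l = a j i
  simp [ite_and]

lemma pairing_injective : Function.Injective (pairing k n) := fun ν ν' h => by
  ext i j hij
  rw [← pairing_path ν j i hij, h, pairing_path]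

lemma pairing_flip_injective : Function.Injective (pairing k n).flip := fun a b h => by
  refine DFunLike.coe_injective (funext₂ fun i j => ?_)
  by_cases hij : i ≤ j
  · rw [← pairing_unit a j i hij, ← pairing_unit b j i hij]
    exact LinearMap.congr_fun h _
  · rw [IncidenceAlgebra.apply_eq_zero_of_not_le hij, IncidenceAlgebra.apply_eq_zero_of_not_le hij]

instance : Module.Finite k (StandardBimodule k n) :=
  inferInstanceAs (Module.Finite k (standardSubmodule k n))

instance : (pairing k n).IsPerfPair :=
  .of_injective pairing_injective pairing_flip_injective

end StandardBimodule

/-! ### Tensoring with a dual bimodule is the Nakayama functor -/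

namespace BalancedTensor

variable {k : Type u} [Field k] {A : Type u} [Ring A] [Algebra k A]
  {M M' : Type u} [AddCommGroup M] [Module Aᵐᵒᵖ M] [AddCommGroup M'] [Module Aᵐᵒᵖ M']
  {N : Type u} [AddCommGroup N] [Module k N] [Module A N] [Module Aᵐᵒᵖ N]
  (p : N →ₗ[k] A →ₗ[k] k)

variable (k M) in
/-- The evaluation at `m`, as a map `Hom_A(M, A) → A`. -/
def evalAt (m : M) : (M →ₗ[Aᵐᵒᵖ] A) →ₗ[k] A where
  toFun φ := φ m
  map_add' _ _ := rfl
  map_smul' _ _ := rfl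

variable (hl : ∀ (ν : N) (a b : A), p (a • ν) b = p ν (b * a))
  (hr : ∀ (ν : N) (a b : A), p (MulOpposite.op a • ν) b = p ν (a * b))

variable (M) in
/-- The map `M ⊗_A N → D Hom_A(M, A)` sending `m ⊗ ν` to `φ ↦ ⟨ν, φ m⟩`, attached to a balanced
pairing between the bimodule `N` and the algebra `A`. -/
noncomputable def toNakayama : BalancedTensor A M N →ₗ[Aᵐᵒᵖ] NakayamaModule k A M :=
  Submodule.liftQ _
    (TensorProduct.AlgebraTensorModule.lift
      { toFun ν := AddMonoidHom.toIntLinearMap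
          { toFun m := show NakayamaModule k A M from (p ν).comp (evalAt k M m)
            map_zero' := LinearMap.ext fun φ => by
              change p ν (φ 0) = 0
              rw [map_zero, map_zero]
            map_add' m m' := LinearMap.ext fun φ => by
              change p ν (φ (m + m')) = p ν (φ m) + p ν (φ m')
              rw [map_add, map_add] }
        map_add' ν ν' := LinearMap.ext fun m => LinearMap.ext fun φ => by
          change p (ν + ν') (φ m) = p ν (φ m) + p ν' (φ m)
          rw [map_add, LinearMap.add_apply]
        map_smul' a ν := LinearMap.ext fun m => LinearMap.ext fun φ => hr ν a.unop (φ m) })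
    (Submodule.span_le.2 <| by
      rintro _ ⟨m, a, ν, rfl⟩
      rw [SetLike.mem_coe, LinearMap.mem_ker, map_sub, sub_eq_zero]
      refine LinearMap.ext fun φ => ?_
      change p ν (φ (MulOpposite.op a • m)) = p (a • ν) (φ m)
      rw [map_smul, hl]
      rfl)

lemma toNakayama_tmul (m : M) (ν : N) (φ : M →ₗ[Aᵐᵒᵖ] A) :
    (toNakayama M p hl hr (tmul m ν)).form φ = p ν (φ m) := rfl

lemma toNakayama_naturality (f : M →ₗ[Aᵐᵒᵖ] M') :
    (toNakayama M' p hl hr).comp (map N f) =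
      (NakayamaModule.map f).comp (toNakayama M p hl hr) :=
  hom_ext fun _ _ => rfl

/-- Evaluation at generators `s i` embeds `Hom_A(M, A)` in `A^n`. A linear form extends to `A^n`,
where perfectness writes it as a sum of pairings with elements `ν i`; the preimage is `∑ s i ⊗ ν i`.
-/
lemma toNakayama_surjective [p.IsPerfPair] [Module.Finite Aᵐᵒᵖ M] :
    Function.Surjective (toNakayama M p hl hr) := fun ξ => by
  obtain ⟨n, s, hs⟩ := Module.Finite.exists_fin (R := Aᵐᵒᵖ) (M := M)
  let ev : (M →ₗ[Aᵐᵒᵖ] A) →ₗ[k] (Fin n → A) := LinearMap.pi fun i => evalAt k M (s i)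
  have hev : LinearMap.ker ev = ⊥ := LinearMap.ker_eq_bot.2 fun φ ψ h => by
    refine LinearMap.ext_on hs ?_
    rintro _ ⟨i, rfl⟩
    exact congrFun h i
  -- The retraction `g` is only `k`-linear, which is enough to extend `ξ` to `ξ ∘ g`.
  obtain ⟨g, hg⟩ := ev.exists_leftInverse_of_injective hev
  choose ν hν using fun i => (LinearMap.IsPerfPair.bijective_left p).2
    (ξ.form ∘ₗ g ∘ₗ LinearMap.single k (fun _ => A) i)
  refine ⟨∑ i, tmul (s i) (ν i), LinearMap.ext fun φ => ?_⟩
  have h : ξ.form φ = ξ.form (g (ev φ)) :=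
    congrArg ξ.form (LinearMap.congr_fun hg φ).symm
  refine Eq.trans ?_ h.symm
  rw [map_sum]
  refine (LinearMap.sum_apply (M := M →ₗ[Aᵐᵒᵖ] A) (M₂ := k) Finset.univ
    (fun i => (toNakayama M p hl hr (tmul (s i) (ν i))).form) φ).trans ?_
  simp only [toNakayama_tmul, hν]
  rw [← Finset.univ_sum_single (ev φ), map_sum, map_sum]
  rfl

/-- By perfectness every `k`-linear form `ℓ` on `M ⊗_A N` is evaluation at some `Φ` in `Hom_A(M,
A)`. An element of the kernel is thus killed by all linear forms, so it is zero. -/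
lemma toNakayama_injective [IsScalarTower k Aᵐᵒᵖ N] [p.IsPerfPair] :
    Function.Injective (toNakayama M p hl hr) := by
  rw [injective_iff_map_eq_zero]
  intro t ht
  rw [← Module.forall_dual_apply_eq_zero_iff k]
  intro ℓ
  -- The field acts on the tensor product through `N`; the scalar tower over `Aᵐᵒᵖ` lets this action
  -- descend to the quotient.
  have hsmul (m : M) (c : k) (ν : N) :
      (tmul m (c • ν) : BalancedTensor A M N) = c • tmul m ν := rfl
  choose φ hφ using fun m : M => (LinearMap.IsPerfPair.bijective_right p).2
    { toFun ν := ℓ (tmul m ν)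
      map_add' ν ν' := by rw [tmul_add, map_add]
      map_smul' c ν := by rw [hsmul, map_smul, RingHom.id_apply] }
  replace hφ (m : M) (ν : N) : p ν (φ m) = ℓ (tmul m ν) := LinearMap.congr_fun (hφ m) ν
  -- Nondegeneracy turns identities tested against all `ν` into additivity and `A`-linearity of `φ`.
  have hinj {a b : A} (h : ∀ ν, p ν a = p ν b) : a = b :=
    (LinearMap.IsPerfPair.bijective_right p).1 (LinearMap.ext h)
  let Φ : M →ₗ[Aᵐᵒᵖ] A :=
    { toFun := φ
      map_add' m m' := hinj fun ν => by
        rw [map_add, hφ, hφ, hφ, add_tmul, map_add]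
      map_smul' a m := hinj fun ν => by
        change p ν _ = p ν (φ m * a.unop)
        rw [← hl, hφ, hφ, ← op_smul_tmul, MulOpposite.op_unop] }
  have key (x : BalancedTensor A M N) : (toNakayama M p hl hr x).form Φ = ℓ x := by
    obtain ⟨y, rfl⟩ := Submodule.Quotient.mk_surjective _ x
    induction y using TensorProduct.induction_on with
    | zero =>
      rw [Submodule.Quotient.mk_zero, map_zero, map_zero]
      rfl
    | tmul ν m => exact hφ m ν
    | add a b ha hb =>
      rw [Submodule.Quotient.mk_add, map_add, map_add, ← ha, ← hb]
      rfl
  rw [← key, ht]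
  rfl

end BalancedTensor

section

variable (k : Type u) [Field k] (A : Type u) [Ring A] [Algebra k A] [Module.Finite k A]
  {N : Type u} [AddCommGroup N] [Module k N] [Module A N] [Module Aᵐᵒᵖ N]
  [SMulCommClass A Aᵐᵒᵖ N] [Module.Finite Aᵐᵒᵖ N]
  [IsScalarTower k Aᵐᵒᵖ N] (p : N →ₗ[k] A →ₗ[k] k) [p.IsPerfPair]

/-- If the `A`-bimodule `N` is dual to the finite-dimensional algebra `A`, then the Nakayama functor
is isomorphic to `- ⊗_A N`. -/
noncomputable def nakayamaIsoTensorFunctor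
    (hl : ∀ (ν : N) (a b : A), p (a • ν) b = p ν (b * a))
    (hr : ∀ (ν : N) (a b : A), p (MulOpposite.op a • ν) b = p ν (a * b)) :
    nakayama k A ≅ tensorFunctor A N :=
  (NatIso.ofComponents (F := tensorFunctor A N) (G := nakayama k A)
    (fun M => (LinearEquiv.ofBijective (BalancedTensor.toNakayama M p hl hr)
      ⟨BalancedTensor.toNakayama_injective p hl hr,
        BalancedTensor.toNakayama_surjective p hl hr⟩).toFGModuleCatIso)
    (fun f => FGModuleCat.hom_ext (BalancedTensor.toNakayama_naturality p hl hr f.hom.hom))).symm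

end

end TypeAQuiver

/-! ### The derived Nakayama functor -/

theorem mainTheorem8 (k : Type u) [Field k] (n : ℕ) (hn : 1 ≤ n)
    [HasDerivedCategory.{w} (TypeAQuiver.ModA k n)] :
    ∃ (_ : BoundedDerived.HasLeftDerived
          (TypeAQuiver.nakayama k (TypeAQuiver.PathAlgebra k n)))
      (_ : BoundedDerived.HasLeftDerived
          (TypeAQuiver.tensorFunctor (TypeAQuiver.PathAlgebra k n)
            (TypeAQuiver.StandardBimodule k n))),
      Nonempty (CategoryTheory.Iso
        (BoundedDerived.leftDerived (TypeAQuiver.nakayama k (TypeAQuiver.PathAlgebra k n)))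
        (BoundedDerived.leftDerived
          (TypeAQuiver.tensorFunctor (TypeAQuiver.PathAlgebra k n)
            (TypeAQuiver.StandardBimodule k n)))) := by
  have hC := fun ⦃K P : TypeAQuiver.ModA k n⦄ (i : K ⟶ P) (_ : CategoryTheory.Mono i)
    (_ : CategoryTheory.Projective P) => FGModuleCat.projective_of_mono
      (TypeAQuiver.submodulesProjective_pathAlgebra k n).pi_fin i
  have h₁ := BoundedDerived.hasLeftDerived_of_hereditary hC
    (TypeAQuiver.nakayama k (TypeAQuiver.PathAlgebra k n))
  have h₂ := BoundedDerived.hasLeftDerived_of_hereditary hC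
    (TypeAQuiver.tensorFunctor (TypeAQuiver.PathAlgebra k n) (TypeAQuiver.StandardBimodule k n))
  exact ⟨h₁, h₂, ⟨BoundedDerived.leftDerivedIso (TypeAQuiver.nakayamaIsoTensorFunctor k
    (TypeAQuiver.PathAlgebra k n) (TypeAQuiver.StandardBimodule.pairing k n)
    TypeAQuiver.StandardBimodule.pairing_smul TypeAQuiver.StandardBimodule.pairing_op_smul)⟩⟩
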